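/- Write $\mathbb{N}=\{1,2,3,\dots\}$. A sequence $r_1<r_2<\cdots$ in $\mathbb{N}$ is *lacunary* if $\inf_n r_{n+1}/r_n>1$. A set $R\subset\mathbb{N}$ is a *set of Bohr recurrence* if for every $d$ and every $\alpha\in\mathbb{T}^d=\mathbb{R}^d/\mathbb{Z}^d$, $0$ lies in the closure of $\{n\alpha:n\in R\}$. A *Bohr almost periodic sequence* is a uniform limit on $\mathbb{N}$ of trigonometric polynomials $n\mapsto\sum_{j=1}^m c_je^{2\pi i n\alpha_j}$ ($c_j\in\mathbb{C}$, $\alpha_j\in\mathbb{R}$). A *$k$-step nilsequence* is a uniform limit on $\mathbb{N}$ of sequences $n\mapsto F(g^nx)$, where $G$ is a $k$-step nilpotent Lie group (its $(k+1)$-st lower central subgroup is trivial, the first being $G$), $\Gamma\subset G$ is a discrete cocompact subgroup, $g\in G$, $x\in G/\Gamma$ and $F:G/\Gamma\to\mathbb{C}$ is continuous. A set $E\subset\mathbb{N}$ is a *$k$-step interpolation set* (resp. an *$I_0$-set*) if every bounded function $E\to\mathbb{C}$ extends to a $k$-step nilsequence (resp. a Bohr almost periodic sequence) on $\mathbb{N}$.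 **Corollary.** Let $\{r_n\}\subset\mathbb{N}$ be lacunary, let $\{t_n\}\subset\mathbb{N}$ satisfy $\lim_{n\to\infty}t_n/r_n=0$, and put $E=\{r_n\}\cup\{r_n+t_n\}$. 1. If $\{t_n\}$ is non-decreasing, then $E$ is a $2$-step interpolation set. 2. If $\{t_n:n\in\mathbb{N}\}$ is a set of Bohr recurrence, then $E$ is not an $I_0$-set. In particular, if $\{t_n\}$ is non-decreasing and is a set of Bohr recurrence, then $E$ is a $2$-step interpolation set but not an $I_0$-set. -/

import Mathlib

open Filter Topology
open scoped Manifold ContDiff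

noncomputable section

/-! Throughout, the positive integers `1, 2, 3, …` are the type `ℕ+`. -/

/-- A sequence `r` of positive integers is lacunary if it is strictly increasing and
`inf_n r (n + 1) / r n > 1`. (The infimum is over a nonempty family of positive reals.) -/
def IsLacunary (r : ℕ → ℕ+) : Prop :=
  StrictMono r ∧ 1 < ⨅ n : ℕ, ((r (n + 1) : ℕ) : ℝ) / ((r n : ℕ) : ℝ)

/-- `R` is a set of Bohr recurrence: for every finite-dimensional torus `(ℝ / ℤ) ^ d` and every
point `α` of it, `0` lies in the closure of `{n α : n ∈ R}`. -/
def IsBohrRecurrent (R : Set ℕ+) : Prop :=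
  ∀ (d : ℕ) (α : Fin d → UnitAddCircle),
    (0 : Fin d → UnitAddCircle) ∈ closure ((fun n : ℕ+ => (n : ℕ) • α) '' R)

/-- A Bohr almost periodic sequence: a uniform limit of trigonometric polynomials
`n ↦ ∑ j, c j * exp (2 π i n α j)` with complex coefficients `c j` and real frequencies `α j`. -/
def IsBohrAlmostPeriodic (ψ : ℕ+ → ℂ) : Prop :=
  ∀ ε : ℝ, 0 < ε → ∃ (k : ℕ) (c : Fin k → ℂ) (α : Fin k → ℝ), ∀ n : ℕ+,
    ‖ψ n - ∑ j, c j * Complex.exp (2 * Real.pi * Complex.I * ((n : ℕ) : ℂ) * (α j : ℂ))‖ < ε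

/-- `E` is an interpolation set for the class `S` of sequences: every bounded complex function on
`E` is the restriction to `E` of a member of `S`. -/
def IsInterpolationSet (S : (ℕ+ → ℂ) → Prop) (E : Set ℕ+) : Prop :=
  ∀ f : E → ℂ, (∃ C : ℝ, ∀ n : E, ‖f n‖ ≤ C) → ∃ ψ : ℕ+ → ℂ, S ψ ∧ ∀ n : E, ψ n = f n

/-- An `I₀`-set: an interpolation set for Bohr almost periodic sequences. -/
def IsI0Set (E : Set ℕ+) : Prop :=
  IsInterpolationSet IsBohrAlmostPeriodic E

/-- `G ⧸ Γ` is a `k`-step nilmanifold: `G` is a (finite-dimensional, real, Hausdorff, second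
countable) Lie group whose `(k+1)`-st lower central subgroup is trivial (in Mathlib's indexing the
series starts with `G` at index `0`), and `Γ` is a discrete cocompact subgroup. -/
structure IsNilmanifold (k : ℕ) (V : Type) [NormedAddCommGroup V] [NormedSpace ℝ V]
    (G : Type) [Group G] [TopologicalSpace G] [ChartedSpace V G] (Γ : Subgroup G) : Prop where
  finiteDimensional : FiniteDimensional ℝ V
  lieGroup : LieGroup 𝓘(ℝ, V) ∞ G
  t2Space : T2Space G
  secondCountable : SecondCountableTopology G
  nilpotent : (⊤ : Subgroup G).lowerCentralSeries k = ⊥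
  discrete : DiscreteTopology Γ
  cocompact : CompactSpace (G ⧸ Γ)

/-- A basic `k`-step nilsequence: `n ↦ F (g ^ n x)` for a `k`-step nilmanifold `G ⧸ Γ`, an element
`g` of `G`, a point `x` of `G ⧸ Γ` and a continuous function `F : G ⧸ Γ → ℂ`. -/
def IsBasicNilsequence (k : ℕ) (ψ : ℕ+ → ℂ) : Prop :=
  ∃ (V : Type) (_ : NormedAddCommGroup V) (_ : NormedSpace ℝ V)
    (G : Type) (_ : Group G) (_ : TopologicalSpace G) (_ : ChartedSpace V G) (Γ : Subgroup G),
    IsNilmanifold k V G Γ ∧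
      ∃ (g : G) (x : G ⧸ Γ) (F : G ⧸ Γ → ℂ), Continuous F ∧ ∀ n : ℕ+, ψ n = F (g ^ (n : ℕ) • x)

/-- A `k`-step nilsequence: a uniform limit of basic `k`-step nilsequences. -/
def IsNilsequence (k : ℕ) (ψ : ℕ+ → ℂ) : Prop :=
  ∀ ε : ℝ, 0 < ε → ∃ φ : ℕ+ → ℂ, IsBasicNilsequence k φ ∧ ∀ n : ℕ+, ‖ψ n - φ n‖ < ε

/-- A `k`-step interpolation set: an interpolation set for `k`-step nilsequences. -/
def IsNilInterpolationSet (k : ℕ) (E : Set ℕ+) : Prop :=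
  IsInterpolationSet (IsNilsequence k) E

end

/-!
Call `n ↦ n² α + n β` modulo `1` a quadratic phase. Continuous functions of finitely many quadratic
phases are `2`-step nilsequences: they are read off along an orbit on the quotient of the group
`ℝ × ℝ^ι × ℝ^ι` with law `(a, b, c) (a', b', c') = (a + a', b + b', c + c' + a' b)` by its integer
points (`isBasicNilsequence_quadraticPhase`). Hence `E` is a `2`-step interpolation set as soon as
any two disjoint subsets `A`, `B` of `E` are kept a fixed distance apart by finitely many quadratic
phases: the space of ultrafilters on `E` then embeds in a product of circles, Tietze's theorem
extends bounded functions on `E` to that product, and continuous functions there are uniform limits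
of functions of finitely many coordinates
(`isNilInterpolationSet_of_quadraticallySeparated`).

For the separation, `E` is cut, up to finitely many points, into sequences along arithmetic
progressions of indices, so sparse that all ratios are large. Multiples of a sparse sequence of
reals can be steered to arbitrary points of the circle (`exists_norm_mul_sub_le`). For two
sequences `a`, `b` among these pieces it suffices to separate `a k` from `b k` by one phase
(`QuadraticallySeparated.range_prod_range`): cut the indices into finitely many classes on which
the phase of `a k` is nearly constant; inside a class that phase separates `a k` from `b m` for all
`k`, `m`, and across two classes only one entry of each pair matters, so that a linear phase
can be steered. For pieces at different indices, or along different progressions, a linear phase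
separates `a k` from `b k` since `b k - a k` is sparse. For `a k = r n` and `b k = r n + t n` the
difference `t n` need not be lacunary, but `(r n + t n)² - r n² = t n (2 r n + t n)` is, because `t`
does not decrease; this is where a quadratic phase is needed.

Conversely a trigonometric polynomial takes nearly the same value at `r n` and `r n + t n` whenever
`t n α` is close to `0` for each of its frequencies `α`. If `{t n}` is a set of Bohr recurrence this
happens for arbitrarily large `n`, so no Bohr almost periodic sequence is `0` at all `r n` and `1`
at all `r n + t n` with `n` large (`not_isI0Set_of_isBohrRecurrent`).
-/

/-! ### The nilmanifold of quadratic phases -/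

/-- The manifold `ℝ × ℝ^ι × ℝ^ι`, carrying the group law
`(a, b, c) (a', b', c') = (a + a', b + b', c + c' + a' b)`. -/
def QuadraticGroup (ι : Type) : Type := ℝ × (ι → ℝ) × (ι → ℝ)

namespace QuadraticGroup

variable {ι : Type}

instance : TopologicalSpace (QuadraticGroup ι) :=
  inferInstanceAs (TopologicalSpace (ℝ × (ι → ℝ) × (ι → ℝ)))

instance : T2Space (QuadraticGroup ι) :=
  inferInstanceAs (T2Space (ℝ × (ι → ℝ) × (ι → ℝ)))

instance [Fintype ι] : SecondCountableTopology (QuadraticGroup ι) :=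
  inferInstanceAs (SecondCountableTopology (ℝ × (ι → ℝ) × (ι → ℝ)))

instance [Fintype ι] : ChartedSpace (ℝ × (ι → ℝ) × (ι → ℝ)) (QuadraticGroup ι) :=
  inferInstanceAs (ChartedSpace (ℝ × (ι → ℝ) × (ι → ℝ)) (ℝ × (ι → ℝ) × (ι → ℝ)))

instance : Group (QuadraticGroup ι) where
  mul x y := (x.1 + y.1, x.2.1 + y.2.1, x.2.2 + y.2.2 + y.1 • x.2.1)
  one := (0, 0, 0)
  inv x := (-x.1, -x.2.1, -x.2.2 + x.1 • x.2.1)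
  mul_assoc x y z := by
    refine Prod.ext (add_assoc _ _ _) (Prod.ext (add_assoc _ _ _) ?_)
    change x.2.2 + y.2.2 + y.1 • x.2.1 + z.2.2 + z.1 • (x.2.1 + y.2.1) =
      x.2.2 + (y.2.2 + z.2.2 + z.1 • y.2.1) + (y.1 + z.1) • x.2.1
    module
  one_mul x := by
    refine Prod.ext (zero_add _) (Prod.ext (zero_add _) ?_)
    change 0 + x.2.2 + x.1 • (0 : ι → ℝ) = x.2.2
    simp
  mul_one x := by
    refine Prod.ext (add_zero _) (Prod.ext (add_zero _) ?_)
    change x.2.2 + 0 + (0 : ℝ) • x.2.1 = x.2.2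
    simp
  inv_mul_cancel x := by
    refine Prod.ext (neg_add_cancel _) (Prod.ext (neg_add_cancel _) ?_)
    change -x.2.2 + x.1 • x.2.1 + x.2.2 + x.1 • (-x.2.1) = 0
    module

@[simp] theorem mul_fst (x y : QuadraticGroup ι) : (x * y).1 = x.1 + y.1 := rfl

@[simp] theorem mul_snd_fst (x y : QuadraticGroup ι) : (x * y).2.1 = x.2.1 + y.2.1 := rfl

@[simp] theorem mul_snd_snd (x y : QuadraticGroup ι) :
    (x * y).2.2 = x.2.2 + y.2.2 + y.1 • x.2.1 := rfl

@[simp] theorem one_fst : (1 : QuadraticGroup ι).1 = 0 := rfl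

@[simp] theorem one_snd_fst : (1 : QuadraticGroup ι).2.1 = 0 := rfl

@[simp] theorem one_snd_snd : (1 : QuadraticGroup ι).2.2 = 0 := rfl

@[simp] theorem inv_fst (x : QuadraticGroup ι) : x⁻¹.1 = -x.1 := rfl

@[simp] theorem inv_snd_fst (x : QuadraticGroup ι) : x⁻¹.2.1 = -x.2.1 := rfl

@[simp] theorem inv_snd_snd (x : QuadraticGroup ι) : x⁻¹.2.2 = -x.2.2 + x.1 • x.2.1 := rfl

theorem ext {x y : QuadraticGroup ι} (h₁ : x.1 = y.1) (h₂ : x.2.1 = y.2.1)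
    (h₃ : x.2.2 = y.2.2) : x = y :=
  Prod.ext h₁ (Prod.ext h₂ h₃)

theorem lieGroup [Fintype ι] :
    LieGroup 𝓘(ℝ, ℝ × (ι → ℝ) × (ι → ℝ)) ∞ (QuadraticGroup ι) where
  toIsManifold := inferInstanceAs
    (IsManifold 𝓘(ℝ, ℝ × (ι → ℝ) × (ι → ℝ)) ∞ (ℝ × (ι → ℝ) × (ι → ℝ)))
  contMDiff_mul := by
    have h : ContDiff ℝ ∞ (fun p : (ℝ × (ι → ℝ) × (ι → ℝ)) × (ℝ × (ι → ℝ) × (ι → ℝ)) =>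
        (p.1.1 + p.2.1, p.1.2.1 + p.2.2.1, p.1.2.2 + p.2.2.2 + p.2.1 • p.1.2.1)) := by
      fun_prop
    have h' := h.contMDiff
    rw [modelWithCornersSelf_prod, ← chartedSpaceSelf_prod] at h'
    exact h'
  contMDiff_inv := by
    have h : ContDiff ℝ ∞ (fun p : ℝ × (ι → ℝ) × (ι → ℝ) =>
        (-p.1, -p.2.1, -p.2.2 + p.1 • p.2.1)) := by
      fun_prop
    exact h.contMDiff

/-- The third lower central subgroup is trivial: commutators lie in the central subgroup
`{(0, 0, c)}`. -/
theorem lowerCentralSeries_two : (⊤ : Subgroup (QuadraticGroup ι)).lowerCentralSeries 2 = ⊥ := by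
  rw [Subgroup.lowerCentralSeries_succ, Subgroup.top_lowerCentralSeries_one,
    Subgroup.commutator_eq_bot_iff_le_centralizer, commutator_def, Subgroup.commutator_le]
  intro x _ y _
  rw [Subgroup.mem_centralizer_iff]
  intro z _
  rw [commutatorElement_def]
  refine ext ?_ ?_ ?_
  · simp only [mul_fst, inv_fst]
    ring
  · simp only [mul_snd_fst, inv_snd_fst]
    module
  · simp only [mul_fst, mul_snd_fst, mul_snd_snd, inv_fst, inv_snd_fst, inv_snd_snd]
    module

variable (ι) in
/-- The subgroup of integer points. -/
def lattice : Subgroup (QuadraticGroup ι) where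
  carrier := {x | (∃ m : ℤ, x.1 = m) ∧ (∀ i, ∃ m : ℤ, x.2.1 i = m) ∧ ∀ i, ∃ m : ℤ, x.2.2 i = m}
  mul_mem' := by
    rintro x y ⟨⟨m, hm⟩, hx, hx'⟩ ⟨⟨n, hn⟩, hy, hy'⟩
    refine ⟨⟨m + n, by simp [hm, hn]⟩, fun i => ?_, fun i => ?_⟩
    · obtain ⟨p, hp⟩ := hx i
      obtain ⟨q, hq⟩ := hy i
      exact ⟨p + q, by simp [hp, hq]⟩
    · obtain ⟨p, hp⟩ := hx i
      obtain ⟨p', hp'⟩ := hx' i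
      obtain ⟨q', hq'⟩ := hy' i
      exact ⟨p' + q' + n * p, by simp [hp, hp', hq', hn]⟩
  one_mem' := ⟨⟨0, by simp⟩, fun i => ⟨0, by simp⟩,
    fun i => ⟨0, by simp⟩⟩
  inv_mem' := by
    rintro x ⟨⟨m, hm⟩, hx, hx'⟩
    refine ⟨⟨-m, by simp [hm]⟩, fun i => ?_, fun i => ?_⟩
    · obtain ⟨p, hp⟩ := hx i
      exact ⟨-p, by simp [hp]⟩
    · obtain ⟨p, hp⟩ := hx i
      obtain ⟨p', hp'⟩ := hx' i
      exact ⟨-p' + m * p, by simp [hp, hp', hm]⟩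

theorem discreteTopology_lattice [Fintype ι] : DiscreteTopology (lattice ι) := by
  -- An integer of absolute value less than `1` is zero, so the unit box isolates the identity.
  have := lieGroup (ι := ι)
  have := topologicalGroup_of_lieGroup 𝓘(ℝ, ℝ × (ι → ℝ) × (ι → ℝ)) ∞ (G := QuadraticGroup ι)
  rw [discreteTopology_iff_isOpen_singleton_one]
  let U : Set (QuadraticGroup ι) :=
    (Metric.ball (0 : ℝ × (ι → ℝ) × (ι → ℝ)) 1 : Set (ℝ × (ι → ℝ) × (ι → ℝ)))
  have hU : IsOpen U := Metric.isOpen_ball (α := ℝ × (ι → ℝ) × (ι → ℝ))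
  refine isOpen_induced_iff.mpr ⟨_, hU, ?_⟩
  have key : ∀ (y : ℝ), (∃ m : ℤ, y = m) → |y| < 1 → y = 0 := by
    rintro y ⟨m, rfl⟩ hm
    rw [← Int.cast_abs, ← Int.cast_one, Int.cast_lt, Int.abs_lt_one_iff] at hm
    simp [hm]
  ext ⟨x, h₁, h₂, h₃⟩
  simp only [Set.mem_preimage, Set.mem_singleton_iff, Subtype.ext_iff,
    Subgroup.coe_one]
  constructor
  · intro (h : dist (α := ℝ × (ι → ℝ) × (ι → ℝ)) x 0 < 1)
    obtain ⟨h, h'⟩ := max_lt_iff.mp h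
    obtain ⟨h', h''⟩ := max_lt_iff.mp h'
    refine ext (key _ h₁ ?_) (funext fun i => key _ (h₂ i) ?_) (funext fun i => key _ (h₃ i) ?_)
    · simpa using h
    · simpa using (dist_le_pi_dist _ _ i).trans_lt h'
    · simpa using (dist_le_pi_dist _ _ i).trans_lt h''
  · rintro rfl
    exact Metric.mem_ball_self (α := ℝ × (ι → ℝ) × (ι → ℝ)) one_pos

theorem compactSpace_quotient_lattice [Fintype ι] :
    CompactSpace (QuadraticGroup ι ⧸ lattice ι) := by
  -- The quotient is the image of the unit cube.
  let K : Set (QuadraticGroup ι) :=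
    (Set.Icc (0 : ℝ × (ι → ℝ) × (ι → ℝ)) 1 : Set (ℝ × (ι → ℝ) × (ι → ℝ)))
  have hK : IsCompact K := isCompact_Icc (α := ℝ × (ι → ℝ) × (ι → ℝ))
  have hK' := hK.image (f := QuotientGroup.mk (s := lattice ι)) continuous_quotient_mk'
  refine ⟨hK'.of_isClosed_subset isClosed_univ fun q _ => ?_⟩
  induction q using Quotient.inductionOn with | h x => ?_
  let y : QuadraticGroup ι := (-(⌊x.1⌋ : ℝ), fun i => -(⌊x.2.1 i⌋ : ℝ),
    fun i => -(⌊x.2.2 i - ⌊x.1⌋ * x.2.1 i⌋ : ℝ))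
  have hy : y ∈ lattice ι :=
    ⟨⟨-⌊x.1⌋, by simp [y]⟩, fun i => ⟨-⌊x.2.1 i⌋, by simp [y]⟩,
      fun i => ⟨-⌊x.2.2 i - ⌊x.1⌋ * x.2.1 i⌋, by simp [y]⟩⟩
  refine ⟨x * y, ?_, ?_⟩
  · have e₁ : (x * y).1 = Int.fract x.1 := (sub_eq_add_neg _ _).symm
    have e₂ : (x * y).2.1 = fun i => Int.fract (x.2.1 i) :=
      funext fun i => (sub_eq_add_neg _ _).symm
    have e₃ : (x * y).2.2 = fun i => Int.fract (x.2.2 i - ⌊x.1⌋ * x.2.1 i) := by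
      funext i
      change x.2.2 i + -(⌊x.2.2 i - ⌊x.1⌋ * x.2.1 i⌋ : ℝ) + -(⌊x.1⌋ : ℝ) * x.2.1 i = _
      rw [Int.fract]
      ring
    refine ⟨⟨?_, ?_, ?_⟩, ?_, ?_, ?_⟩
    · exact e₁ ▸ Int.fract_nonneg _
    · exact e₂ ▸ fun i => Int.fract_nonneg _
    · exact e₃ ▸ fun i => Int.fract_nonneg _
    · exact e₁ ▸ (Int.fract_lt_one _).le
    · exact e₂ ▸ fun i => (Int.fract_lt_one _).le
    · exact e₃ ▸ fun i => (Int.fract_lt_one _).le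
  · refine (Quotient.sound ?_).symm
    change (QuotientGroup.leftRel (lattice ι)) x (x * y)
    rw [QuotientGroup.leftRel_apply]
    simpa using hy

theorem isNilmanifold [Fintype ι] :
    IsNilmanifold 2 (ℝ × (ι → ℝ) × (ι → ℝ)) (QuadraticGroup ι) (lattice ι) where
  finiteDimensional := inferInstance
  lieGroup := lieGroup
  t2Space := inferInstance
  secondCountable := inferInstance
  nilpotent := lowerCentralSeries_two
  discrete := discreteTopology_lattice
  cocompact := compactSpace_quotient_lattice

theorem pow_fst (x : QuadraticGroup ι) (n : ℕ) : (x ^ n).1 = n * x.1 := by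
  induction n with
  | zero => simp
  | succ n ih =>
    rw [pow_succ, mul_fst, ih]
    push_cast
    ring

theorem pow_snd_fst (x : QuadraticGroup ι) (n : ℕ) : (x ^ n).2.1 = (n : ℝ) • x.2.1 := by
  induction n with
  | zero => simp
  | succ n ih =>
    rw [pow_succ, mul_snd_fst, ih]
    push_cast
    module

theorem pow_snd_snd (x : QuadraticGroup ι) (n : ℕ) :
    (x ^ n).2.2 = (n : ℝ) • x.2.2 + ((n : ℝ) * (n - 1) / 2 * x.1) • x.2.1 := by
  induction n with
  | zero => simp
  | succ n ih =>
    rw [pow_succ, mul_snd_snd, pow_snd_fst, ih]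
    push_cast
    module

/-- Given `F` on a torus, the function on the group whose value at `(a, b, c)` is an average of
the values `F (c + k b)`, `k ∈ ℤ`, weighted by a bump function of `a + k`. The weight is
`δ_{k, -n}` at an integer `a = n`. -/
noncomputable def lift (F : (ι → UnitAddCircle) → ℂ) (x : QuadraticGroup ι) : ℂ :=
  ∑ᶠ k : ℤ, ((max 0 (1 - |x.1 + k|) : ℝ) : ℂ) * F (fun i => ((x.2.2 i + k * x.2.1 i : ℝ)))

theorem continuous_lift {F : (ι → UnitAddCircle) → ℂ} (hF : Continuous F) :
    Continuous (lift F) := by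
  have c₁ : Continuous (fun x : QuadraticGroup ι => x.1) := continuous_fst
  have c₂ : Continuous (fun x : QuadraticGroup ι => x.2.1) := continuous_fst.comp continuous_snd
  have c₃ : Continuous (fun x : QuadraticGroup ι => x.2.2) := continuous_snd.comp continuous_snd
  refine continuous_finsum (fun k => ?_) ?_
  · refine Continuous.mul (by fun_prop) (hF.comp (continuous_pi fun i => ?_))
    exact (AddCircle.continuous_mk' _).comp (by fun_prop)
  · intro x
    refine ⟨{y | dist y.1 x.1 < 1}, ?_, ?_⟩
    · exact (isOpen_lt (c₁.dist continuous_const) continuous_const).mem_nhds (by simp)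
    · refine (Set.finite_Icc (⌊-x.1 - 2⌋) (⌈-x.1 + 2⌉)).subset ?_
      rintro k ⟨y, hy, hyx⟩
      have h : |y.1 + k| < 1 := by
        by_contra hcon
        refine hy ?_
        simp only
        rw [max_eq_left (by linarith), Complex.ofReal_zero, zero_mul]
      have h' : |y.1 - x.1| < 1 := hyx
      rw [abs_lt] at h h'
      constructor
      · exact Int.cast_le (R := ℝ).mp ((Int.floor_le _).trans (by linarith))
      · exact Int.cast_le (R := ℝ).mp (le_trans (by linarith) (Int.le_ceil _))

/-- Right translation by a lattice point with first coordinate `m` shifts the summation index by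
`m` and the arguments of `F` by integers. -/
theorem lift_mul_of_mem_lattice (F : (ι → UnitAddCircle) → ℂ) (x : QuadraticGroup ι)
    {y : QuadraticGroup ι} (hy : y ∈ lattice ι) : lift F (x * y) = lift F x := by
  obtain ⟨⟨m, hm⟩, h₂, h₃⟩ := hy
  unfold lift
  conv_rhs => rw [← finsum_comp_equiv (Equiv.addLeft m)]
  refine finsum_congr fun k => ?_
  congr 2
  · simp only [mul_fst, hm, Equiv.coe_addLeft, Int.cast_add]
    congr 3
    ring
  · funext i
    obtain ⟨p, hp⟩ := h₂ i
    obtain ⟨q, hq⟩ := h₃ i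
    rw [← sub_eq_zero, ← AddCircle.coe_sub, AddCircle.coe_eq_zero_iff]
    refine ⟨q + k * p, ?_⟩
    simp [hm, hp, hq]
    ring

theorem lift_of_fst_eq_natCast (F : (ι → UnitAddCircle) → ℂ) {x : QuadraticGroup ι} {n : ℕ}
    (hx : x.1 = n) : lift F x = F (fun i => ((x.2.2 i - n * x.2.1 i : ℝ))) := by
  rw [lift, finsum_eq_single _ (-n : ℤ)]
  · simp [hx, sub_eq_add_neg]
  · intro k hk
    have h : 1 ≤ |(n : ℤ) + k| := Int.one_le_abs (by omega)
    have h' : (1 : ℝ) ≤ |(n : ℝ) + k| := by exact_mod_cast h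
    rw [hx, max_eq_left (by linarith), Complex.ofReal_zero, zero_mul]

end QuadraticGroup

/-- The quadratic phase `n ↦ n² α + n β` modulo `1`, where `p = (α, β)`. -/
noncomputable def quadraticPhase (p : ℝ × ℝ) (n : ℕ) : UnitAddCircle :=
  ((n ^ 2 * p.1 + n * p.2 : ℝ) : UnitAddCircle)

/-- A continuous function of finitely many quadratic phases is a basic `2`-step nilsequence: the
orbit of the identity coset under `(1, α, γ)` stays in the compact set of cosets with integral first
coordinate, on which `QuadraticGroup.lift F` is a function of quadratic phases. -/
theorem isBasicNilsequence_quadraticPhase {ι : Type} [Fintype ι] (p : ι → ℝ × ℝ)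
    {F : (ι → UnitAddCircle) → ℂ} (hF : Continuous F) :
    IsBasicNilsequence 2 (fun n : ℕ+ => F (fun i => quadraticPhase (p i) n)) := by
  -- For `g = (1, α, γ)` the phase is `n γ + n (n - 1) / 2 α - n² α = n² (-α / 2) + n (γ - α / 2)`.
  let g : QuadraticGroup ι := (1, fun i => -2 * (p i).1, fun i => (p i).2 - (p i).1)
  refine ⟨ℝ × (ι → ℝ) × (ι → ℝ), inferInstance, inferInstance, QuadraticGroup ι, inferInstance,
    inferInstance, inferInstance, QuadraticGroup.lattice ι, QuadraticGroup.isNilmanifold, g,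
    ((1 : QuadraticGroup ι) : QuadraticGroup ι ⧸ QuadraticGroup.lattice ι),
    Quotient.lift (QuadraticGroup.lift F) ?_, ?_, ?_⟩
  · intro x y hxy
    have h := QuotientGroup.leftRel_apply.mp hxy
    simpa using (QuadraticGroup.lift_mul_of_mem_lattice F x h).symm
  · exact (QuadraticGroup.continuous_lift hF).quotient_lift _
  · intro n
    change _ = QuadraticGroup.lift F (g ^ (n : ℕ) * 1)
    rw [mul_one, QuadraticGroup.lift_of_fst_eq_natCast F (n := n)]
    · refine congrArg F (funext fun i => ?_)
      rw [quadraticPhase, QuadraticGroup.pow_snd_fst, QuadraticGroup.pow_snd_snd]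
      congr 1
      simp [g]
      ring
    · rw [QuadraticGroup.pow_fst]
      exact mul_one _

/-! ### Interpolation from separation of disjoint subsets -/

/-- A set `W` of pairs is quadratically separated if finitely many quadratic phases suffice to keep
the two entries of every pair in `W` a fixed distance apart. -/
def QuadraticallySeparated (W : Set (ℕ+ × ℕ+)) : Prop :=
  ∃ (Φ : Finset (ℝ × ℝ)) (δ : ℝ), 0 < δ ∧ ∀ w ∈ W, ∃ p ∈ Φ,
    δ ≤ dist (quadraticPhase p w.1) (quadraticPhase p w.2)

namespace QuadraticallySeparated

theorem mono {W W' : Set (ℕ+ × ℕ+)} (h : QuadraticallySeparated W') (hW : W ⊆ W') :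
    QuadraticallySeparated W := by
  obtain ⟨Φ, δ, hδ, H⟩ := h
  exact ⟨Φ, δ, hδ, fun w hw => H w (hW hw)⟩

theorem of_phase {W : Set (ℕ+ × ℕ+)} (p : ℝ × ℝ) {δ : ℝ} (hδ : 0 < δ)
    (h : ∀ w ∈ W, δ ≤ dist (quadraticPhase p w.1) (quadraticPhase p w.2)) :
    QuadraticallySeparated W :=
  ⟨{p}, δ, hδ, fun w hw => ⟨p, by simp, h w hw⟩⟩

theorem iUnion {κ : Type*} [Finite κ] {W : κ → Set (ℕ+ × ℕ+)}
    (h : ∀ k, QuadraticallySeparated (W k)) : QuadraticallySeparated (⋃ k, W k) := by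
  classical
  have := Fintype.ofFinite κ
  choose Φ δ hδ H using h
  obtain ⟨ε, hε, hεδ⟩ : ∃ ε : ℝ, 0 < ε ∧ ∀ k, ε ≤ δ k := by
    cases isEmpty_or_nonempty κ
    · exact ⟨1, one_pos, fun k => isEmptyElim k⟩
    · obtain ⟨k₀, hk₀⟩ := Finite.exists_min δ
      exact ⟨δ k₀, hδ k₀, hk₀⟩
  refine ⟨Finset.univ.biUnion Φ, ε, hε, fun w hw => ?_⟩
  obtain ⟨k, hk⟩ := Set.mem_iUnion.mp hw
  obtain ⟨p, hp, hd⟩ := H k w hk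
  exact ⟨p, Finset.mem_biUnion.mpr ⟨k, Finset.mem_univ _, hp⟩, (hεδ k).trans hd⟩

theorem union {W W' : Set (ℕ+ × ℕ+)} (h : QuadraticallySeparated W)
    (h' : QuadraticallySeparated W') : QuadraticallySeparated (W ∪ W') := by
  rw [Set.union_eq_iUnion]
  exact iUnion (by rintro (_ | _) <;> assumption)

theorem swap {W : Set (ℕ+ × ℕ+)} (h : QuadraticallySeparated W) :
    QuadraticallySeparated (Prod.swap ⁻¹' W) := by
  obtain ⟨Φ, δ, hδ, H⟩ := h
  refine ⟨Φ, δ, hδ, fun w hw => ?_⟩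
  obtain ⟨p, hp, hd⟩ := H _ hw
  exact ⟨p, hp, by rwa [dist_comm]⟩

end QuadraticallySeparated

/-- A continuous function on a compact product is uniformly close to its restriction to the slice
where all but finitely many coordinates are set to `0`. -/
theorem exists_finset_dist_extend_zero_lt {κ X : Type*} [DecidableEq κ] [UniformSpace X] [Zero X]
    [CompactSpace X] {g : (κ → X) → ℂ} (hg : Continuous g) {ε : ℝ} (hε : 0 < ε) :
    ∃ s : Finset κ, ∀ x : κ → X, dist (g x) (g fun k => if k ∈ s then x k else 0) < ε := by
  have hu := CompactSpace.uniformContinuous_of_continuous hg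
  have hV := hu (Metric.dist_mem_uniformity hε)
  rw [Filter.mem_map, Pi.uniformity, Filter.mem_iInf'] at hV
  obtain ⟨I, hI, V, hV, -, hVI, -⟩ := hV
  refine ⟨hI.toFinset, fun x => ?_⟩
  have hmem : (x, fun k => if k ∈ hI.toFinset then x k else 0) ∈ ⋂ i ∈ I, V i := by
    refine Set.mem_iInter₂.mpr fun i hi => ?_
    obtain ⟨U, hU, hUV⟩ := Filter.mem_comap.mp (hV i)
    refine hUV ?_
    simpa [hi] using refl_mem_uniformity hU
  exact hVI.symm.subset hmem

/-- The map from the space of ultrafilters on `E` to the product of all circles that extends the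
family of all quadratic phases. -/
noncomputable def phaseLimit (E : Set ℕ+) : Ultrafilter E → (ℝ × ℝ → UnitAddCircle) :=
  Ultrafilter.extend fun (n : E) p => quadraticPhase p n

/-- Any two complementary subsets of `E` have disjoint closures in a finite-dimensional torus, so
distinct ultrafilters on `E` have distinct limits. -/
theorem phaseLimit_injective {E : Set ℕ+}
    (hE : ∀ A B : Set ℕ+, A ⊆ E → B ⊆ E → Disjoint A B → QuadraticallySeparated (A ×ˢ B)) :
    Function.Injective (phaseLimit E) := by
  intro u v huv
  by_contra hne
  obtain ⟨A, hAu, hAv⟩ : ∃ A : Set E, A ∈ u ∧ A ∉ v := by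
    by_contra! hcon
    exact hne (Ultrafilter.coe_le_coe.mp hcon).symm
  have hAv' := Ultrafilter.compl_mem_iff_notMem.mpr hAv
  obtain ⟨Φ, δ, hδ, H⟩ := hE ((↑) '' A) ((↑) '' Aᶜ) (by simp) (by simp)
    (by
      rw [Set.disjoint_image_iff Subtype.val_injective]
      exact disjoint_compl_right)
  have hu := ultrafilter_extend_eq_iff.mp (rfl : phaseLimit E u = phaseLimit E u)
  have hv := ultrafilter_extend_eq_iff.mp (huv.symm : phaseLimit E v = phaseLimit E u)
  have hN : {x : ℝ × ℝ → UnitAddCircle | ∀ p ∈ Φ, dist (x p) (phaseLimit E u p) < δ / 2} ∈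
      𝓝 (phaseLimit E u) := by
    refine (Filter.eventually_all_finset Φ).mpr fun p _ => ?_
    exact (continuous_apply (A := fun _ : ℝ × ℝ => UnitAddCircle) p).continuousAt
      (Metric.ball_mem_nhds _ (half_pos hδ))
  obtain ⟨a, haA, ha⟩ := u.nonempty_of_mem (Filter.inter_mem hAu (hu hN))
  obtain ⟨b, hbA, hb⟩ := v.nonempty_of_mem (Filter.inter_mem hAv' (hv hN))
  obtain ⟨p, hp, hd⟩ := H (a, b) ⟨⟨a, haA, rfl⟩, ⟨b, hbA, rfl⟩⟩
  have h₁ := ha p hp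
  have h₂ := hb p hp
  exact absurd hd (not_le.mpr ((dist_triangle_right _ _ _).trans_lt
    ((add_lt_add h₁ h₂).trans_eq (add_halves δ))))

/-- If disjoint subsets of `E` are quadratically separated, the space of ultrafilters on `E` embeds
in a product of circles, and bounded functions on `E` extend by Tietze's theorem. -/
theorem isNilInterpolationSet_of_quadraticallySeparated {E : Set ℕ+}
    (hE : ∀ A B : Set ℕ+, A ⊆ E → B ⊆ E → Disjoint A B → QuadraticallySeparated (A ×ˢ B)) :
    IsNilInterpolationSet 2 E := by
  classical
  rintro f ⟨C, hC⟩
  have he : IsClosedEmbedding (phaseLimit E) :=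
    (continuous_ultrafilter_extend _).isClosedEmbedding (phaseLimit_injective hE)
  let f' : E → Metric.closedBall (0 : ℂ) C := fun n => ⟨f n, by simpa using hC n⟩
  have : CompactSpace (Metric.closedBall (0 : ℂ) C) :=
    isCompact_iff_compactSpace.mp (isCompact_closedBall _ _)
  obtain ⟨g, hg⟩ := ContinuousMap.exists_extension' he
    (⟨fun u => ((Ultrafilter.extend f' u : Metric.closedBall (0 : ℂ) C) : ℂ),
      continuous_subtype_val.comp (continuous_ultrafilter_extend f')⟩ : C(Ultrafilter E, ℂ))
  refine ⟨fun n => g fun p => quadraticPhase p n, fun ε hε => ?_, fun n => ?_⟩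
  · obtain ⟨s, hs⟩ := exists_finset_dist_extend_zero_lt g.continuous hε
    have hF : Continuous fun y : s → UnitAddCircle =>
        g fun p => if hp : p ∈ s then y ⟨p, hp⟩ else 0 := by
      refine g.continuous.comp (continuous_pi fun p => ?_)
      by_cases hp : p ∈ s
      · simpa [hp] using continuous_apply _
      · simpa [hp] using continuous_const
    refine ⟨_, isBasicNilsequence_quadraticPhase (fun i : s => (i : ℝ × ℝ)) hF, fun n => ?_⟩
    simpa [dist_eq_norm] using hs fun p => quadraticPhase p n
  · have h := congrFun hg (pure n)
    have e₁ : phaseLimit E (pure n) = fun p => quadraticPhase p n := ultrafilter_extend_pure _ _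
    have e₂ : Ultrafilter.extend f' (pure n) = f' n := ultrafilter_extend_pure _ _
    simpa [e₁, e₂, f'] using h

/-! ### Phases steered along sparse sequences -/

/-- If `c (k + 1) / c k ≥ 5`, a single dilation `α` brings all `c k * α` close to prescribed points
of the circle. -/
theorem exists_norm_mul_sub_le {c : ℕ → ℝ} (hc : ∀ k, 0 < c k) (hc' : ∀ k, 5 * c k ≤ c (k + 1))
    (x : ℕ → ℝ) : ∃ α : ℝ, ∀ k, ‖((c k * α - x k : ℝ) : UnitAddCircle)‖ ≤ 1 / 8 := by
  -- `y (k + 1)` is the point nearest to `y k` at which the `(k + 1)`-st target is attained.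
  let y : ℕ → ℝ := fun k => Nat.rec (x 0 / c 0)
    (fun k z => (x (k + 1) + round (c (k + 1) * z - x (k + 1))) / c (k + 1)) k
  have hy : ∀ k, ∃ z : ℤ, c k * y k = x k + z := by
    rintro (_ | k)
    · exact ⟨0, by
        rw [Int.cast_zero, add_zero]
        exact mul_div_cancel₀ _ (hc 0).ne'⟩
    · exact ⟨round (c (k + 1) * y k - x (k + 1)), mul_div_cancel₀ _ (hc (k + 1)).ne'⟩
  have hstep : ∀ k, dist (y k) (y (k + 1)) ≤ 1 / 2 / c (k + 1) := by
    intro k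
    have h : y k - y (k + 1) = (c (k + 1) * y k - x (k + 1)
        - round (c (k + 1) * y k - x (k + 1))) / c (k + 1) := by
      have : y (k + 1) = (x (k + 1) + round (c (k + 1) * y k - x (k + 1))) / c (k + 1) := rfl
      rw [this]
      field_simp [(hc (k + 1)).ne']
      ring
    rw [Real.dist_eq, h, abs_div, abs_of_pos (hc (k + 1))]
    exact div_le_div_of_nonneg_right (abs_sub_round _) (hc _).le
  have hgrow : ∀ k j, 5 ^ j * c k ≤ c (k + j) := by
    intro k j
    induction j with
    | zero => simp
    | succ j ih =>
      calc (5 : ℝ) ^ (j + 1) * c k = 5 * (5 ^ j * c k) := by ring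
        _ ≤ 5 * c (k + j) := by gcongr
        _ ≤ c (k + (j + 1)) := hc' _
  have hgeom : ∀ k j, dist (y (k + j)) (y (k + (j + 1))) ≤ 1 / 10 / c k * (1 / 5) ^ j := by
    intro k j
    refine (hstep (k + j)).trans ?_
    have h := hgrow k (j + 1)
    have h' : 0 < c k := hc k
    have e : 1 / 10 / c k * (1 / 5) ^ j = 1 / 2 / (5 ^ (j + 1) * c k) := by
      rw [one_div_pow]
      field_simp
      ring
    rw [e]
    exact div_le_div_of_nonneg_left (by norm_num) (by positivity) h
  obtain ⟨α, hα⟩ := cauchySeq_tendsto_of_complete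
    (cauchySeq_of_le_geometric (1 / 5) (1 / 10 / c 0) (by norm_num)
      fun j => by simpa using hgeom 0 j)
  refine ⟨α, fun k => ?_⟩
  have hlim : Tendsto (fun j => y (k + j)) atTop (𝓝 α) := by
    simpa only [add_comm k] using (tendsto_add_atTop_iff_nat k).mpr hα
  have hd := dist_le_of_le_geometric_of_tendsto₀ (1 / 5) (1 / 10 / c k) (by norm_num)
    (hgeom k) hlim
  obtain ⟨z, hz⟩ := hy k
  have h₁ : |y k - α| * c k ≤ 1 / 8 := by
    rw [← le_div_iff₀ (hc k), ← Real.dist_eq]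
    refine hd.trans_eq ?_
    field_simp [(hc k).ne']
    norm_num
  rw [UnitAddCircle.norm_eq]
  refine (round_le _ z).trans ?_
  have e : c k * α - x k - z = -((y k - α) * c k) := by linarith
  rwa [e, abs_neg, abs_mul, abs_of_pos (hc k)]

theorem dist_quadraticPhase (p : ℝ × ℝ) (a b : ℕ) :
    dist (quadraticPhase p a) (quadraticPhase p b) =
      ‖((((b : ℝ) ^ 2 - a ^ 2) * p.1 + ((b : ℝ) - a) * p.2 : ℝ) : UnitAddCircle)‖ := by
  rw [dist_comm, dist_eq_norm, quadraticPhase, quadraticPhase, ← AddCircle.coe_sub]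
  congr 2
  ring

theorem norm_coe_half : ‖((1 / 2 : ℝ) : UnitAddCircle)‖ = 1 / 2 := by
  rw [UnitAddCircle.norm_eq]
  norm_num

theorem le_norm_of_norm_sub_half_le {x : ℝ} (h : ‖((x - 1 / 2 : ℝ) : UnitAddCircle)‖ ≤ 1 / 8) :
    3 / 8 ≤ ‖(x : UnitAddCircle)‖ := by
  have h₁ := norm_sub_norm_le ((1 / 2 : ℝ) : UnitAddCircle) (x : UnitAddCircle)
  rw [norm_sub_rev, norm_coe_half, ← AddCircle.coe_sub] at h₁
  linarith

/-- A sequence of pairs is separated by a linear phase when its differences grow fast. -/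
theorem exists_phase_of_sub {a b : ℕ → ℕ+} (hpos : ∀ k, a k < b k)
    (hgrow : ∀ k, 5 * ((b k : ℝ) - a k) ≤ (b (k + 1) : ℝ) - a (k + 1)) :
    ∃ p : ℝ × ℝ, ∀ k, 3 / 8 ≤ dist (quadraticPhase p (a k)) (quadraticPhase p (b k)) := by
  obtain ⟨α, hα⟩ := exists_norm_mul_sub_le
    (fun k => sub_pos.mpr (by exact_mod_cast hpos k)) hgrow fun _ => 1 / 2
  refine ⟨(0, α), fun k => ?_⟩
  rw [dist_quadraticPhase]
  exact le_norm_of_norm_sub_half_le (by simpa using hα k)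

/-- A sequence of pairs is separated by a quadratic phase when the differences of the squares grow
fast. -/
theorem exists_phase_of_sq_sub {a b : ℕ → ℕ+} (hpos : ∀ k, a k < b k)
    (hgrow : ∀ k, 5 * ((b k : ℝ) ^ 2 - (a k : ℝ) ^ 2) ≤
      (b (k + 1) : ℝ) ^ 2 - (a (k + 1) : ℝ) ^ 2) :
    ∃ p : ℝ × ℝ, ∀ k, 3 / 8 ≤ dist (quadraticPhase p (a k)) (quadraticPhase p (b k)) := by
  have hpos' : ∀ k, 0 < (b k : ℝ) ^ 2 - (a k : ℝ) ^ 2 := fun k => by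
    have h : (a k : ℝ) < b k := by exact_mod_cast hpos k
    exact sub_pos.mpr (by gcongr)
  obtain ⟨α, hα⟩ := exists_norm_mul_sub_le hpos' hgrow fun _ => 1 / 2
  refine ⟨(α, 0), fun k => ?_⟩
  rw [dist_quadraticPhase]
  exact le_norm_of_norm_sub_half_le (by simpa using hα k)

/-- Along a sequence with ratios at least `5`, a linear phase separates any set of indices from its
complement. -/
theorem exists_phase_of_five_mul_le {u : ℕ → ℕ+} (hu : ∀ k, 5 * (u k : ℝ) ≤ u (k + 1))
    (S : Set ℕ) : ∃ p : ℝ × ℝ, ∀ k ∈ S, ∀ m ∉ S,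
      1 / 4 ≤ dist (quadraticPhase p (u k)) (quadraticPhase p (u m)) := by
  classical
  obtain ⟨α, hα⟩ := exists_norm_mul_sub_le (fun k => Nat.cast_pos.mpr (u k).pos) hu
    fun k => if k ∈ S then 0 else 1 / 2
  refine ⟨(0, α), fun k hk m hm => ?_⟩
  have h₁ := hα k
  have h₂ := hα m
  rw [if_pos hk, sub_zero] at h₁
  rw [if_neg hm] at h₂
  have h₃ := le_norm_of_norm_sub_half_le h₂
  have h₄ := norm_sub_norm_le ((u m * α : ℝ) : UnitAddCircle) ((u k * α : ℝ) : UnitAddCircle)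
  rw [← AddCircle.coe_sub] at h₄
  rw [dist_quadraticPhase]
  simp only [mul_zero, zero_add, sub_mul]
  linarith

namespace QuadraticallySeparated

theorem singleton {a b : ℕ+} (hab : a ≠ b) : QuadraticallySeparated {(a, b)} := by
  have h : (b : ℝ) - a ≠ 0 := sub_ne_zero.mpr (by exact_mod_cast hab.symm)
  refine of_phase (0, 1 / 2 / ((b : ℝ) - a)) (δ := 1 / 2) (by norm_num) ?_
  rintro _ rfl
  rw [dist_quadraticPhase, mul_zero, zero_add, mul_div_cancel₀ _ h, norm_coe_half]

theorem of_disjoint_subset_range {u : ℕ → ℕ+} (hu : ∀ k, 5 * (u k : ℝ) ≤ u (k + 1))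
    {A B : Set ℕ+} (hA : A ⊆ Set.range u) (hB : B ⊆ Set.range u) (hAB : Disjoint A B) :
    QuadraticallySeparated (A ×ˢ B) := by
  obtain ⟨p, hp⟩ := exists_phase_of_five_mul_le hu (u ⁻¹' A)
  refine of_phase p (δ := 1 / 4) (by norm_num) ?_
  rintro ⟨x, y⟩ ⟨hx, hy⟩
  obtain ⟨k, rfl⟩ := hA hx
  obtain ⟨m, rfl⟩ := hB hy
  exact hp k hx m fun h => hAB.ne_of_mem h hy rfl

/-- A fast growing sequence is separated from a point not on it: all but finitely many terms exceed
the point, and then the differences grow fast as well. -/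
theorem range_singleton {u : ℕ → ℕ+} (hu : ∀ k, 5 * (u k : ℝ) ≤ u (k + 1)) (m : ℕ+) :
    QuadraticallySeparated {w | w.1 ∈ Set.range u ∧ w.1 ≠ m ∧ w.2 = m} := by
  have hmono : StrictMono u := strictMono_nat_of_lt_succ fun k => by
    have h := hu k
    have h' : (0 : ℝ) < u k := Nat.cast_pos.mpr (u k).pos
    have : (u k : ℝ) < u (k + 1) := by linarith
    exact_mod_cast this
  obtain ⟨N, hN⟩ : ∃ N, m < u N :=
    ⟨m + 1, PNat.coe_lt_coe _ _ |>.mp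
      (StrictMono.le_apply (f := fun k => (u k : ℕ)) fun _ _ h => hmono h)⟩
  obtain ⟨p, hp⟩ := exists_phase_of_sub (a := fun _ => m) (b := fun k => u (N + k))
    (fun k => hN.trans_le (hmono.monotone (Nat.le_add_right _ _))) (fun k => by
      have h := hu (N + k)
      have h' : (0 : ℝ) < m := Nat.cast_pos.mpr m.pos
      rw [add_assoc] at h
      linarith)
  have h₁ : QuadraticallySeparated {w | ∃ k, w = (u (N + k), m)} := by
    refine of_phase p (δ := 3 / 8) (by norm_num) ?_
    rintro _ ⟨k, rfl⟩
    rw [dist_comm]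
    exact hp k
  have h₂ : QuadraticallySeparated (⋃ k : {k : Fin N // u k ≠ m}, {(u k, m)}) :=
    iUnion fun k => singleton k.2
  refine (h₁.union h₂).mono ?_
  rintro ⟨_, _⟩ ⟨⟨k, rfl⟩, hk, rfl⟩
  rcases le_or_gt N k with h | h
  · exact Or.inl ⟨k - N, by rw [Nat.add_sub_cancel' h]⟩
  · exact Or.inr (Set.mem_iUnion.mpr ⟨⟨⟨k, h⟩, hk⟩, rfl⟩)

/-- Suppose that every choice of one entry from each pair `(a k, b k)` gives a fast growing
sequence, and that one phase separates the two entries of every pair. Then `a k` and `b m` are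
separated for all `k` and `m`: on the classes of indices along which the phase of `a k` is nearly
constant the given phase works, and two different classes are separated by a linear phase. -/
theorem range_prod_range {a b : ℕ → ℕ+} (haa : ∀ k, 5 * (a k : ℝ) ≤ a (k + 1))
    (hab : ∀ k, 5 * (a k : ℝ) ≤ b (k + 1)) (hba : ∀ k, 5 * (b k : ℝ) ≤ a (k + 1))
    (hbb : ∀ k, 5 * (b k : ℝ) ≤ b (k + 1)) {p : ℝ × ℝ} {δ : ℝ} (hδ : 0 < δ)
    (hp : ∀ k, δ ≤ dist (quadraticPhase p (a k)) (quadraticPhase p (b k))) :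
    QuadraticallySeparated (Set.range a ×ˢ Set.range b) := by
  classical
  obtain ⟨T, -, hTfin, hT⟩ := finite_cover_balls_of_compact
    (isCompact_univ (X := UnitAddCircle)) (show 0 < δ / 4 by linarith)
  have hcell : ∀ k, ∃ x : T, dist (quadraticPhase p (a k)) x < δ / 4 := fun k => by
    obtain ⟨x, hx, hd⟩ := Set.mem_iUnion₂.mp (hT (Set.mem_univ (quadraticPhase p (a k))))
    exact ⟨⟨x, hx⟩, hd⟩
  choose cell hcell using hcell
  have := hTfin.to_subtype
  have key : ∀ x : T × T,
      QuadraticallySeparated {w | ∃ k m, cell k = x.1 ∧ cell m = x.2 ∧ w = (a k, b m)} := by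
    rintro ⟨x, x'⟩
    rcases eq_or_ne x x' with rfl | hne
    · refine of_phase p (half_pos hδ) ?_
      rintro _ ⟨k, m, hk, hm, rfl⟩
      have h₁ := hcell k
      have h₂ := hcell m
      rw [hk] at h₁
      rw [hm] at h₂
      have h₃ := hp m
      have h₄ := dist_triangle_right (quadraticPhase p (a m)) (quadraticPhase p (a k))
        (x : UnitAddCircle)
      have h₅ := dist_triangle (quadraticPhase p (a m)) (quadraticPhase p (a k))
        (quadraticPhase p (b m))
      simp only
      linarith
    · obtain ⟨q, hq⟩ := exists_phase_of_five_mul_le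
        (u := fun k => if cell k = x then a k else b k) (fun k => by
          split_ifs
          exacts [haa k, hab k, hba k, hbb k]) {k | cell k = x}
      refine of_phase q (δ := 1 / 4) (by norm_num) ?_
      rintro _ ⟨k, m, hk, hm, rfl⟩
      have hm' : cell m ≠ x := fun h => hne (h.symm.trans hm)
      simpa [hk, hm'] using hq k hk m hm'
  refine (iUnion key).mono ?_
  rintro ⟨_, _⟩ ⟨⟨k, rfl⟩, ⟨m, rfl⟩⟩
  exact Set.mem_iUnion.mpr ⟨(cell k, cell m), k, m, rfl, rfl, rfl⟩

end QuadraticallySeparated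

/-! ### Pairs of lacunary sequences -/

namespace QuadraticallySeparated

/-- Arithmetic progressions of indices `i + 2 L k` and `j + 2 L k` with `i < j ≤ i + L`: the
differences of the paired entries grow fast, so one linear phase separates all pairs. -/
theorem range_prod_range_of_lt_of_le {a b : ℕ → ℕ+} {θ : ℝ} {L : ℕ} (hθ₀ : 0 ≤ θ) (hθ₁ : θ < 1)
    (hθ : ∀ n m, n < m → (a n : ℝ) ≤ θ * b m)
    (haa : ∀ n m, n + L ≤ m → 5 * (a n : ℝ) ≤ (1 - θ) * a m)
    (hab : ∀ n m, n + L ≤ m → 5 * (a n : ℝ) ≤ (1 - θ) * b m)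
    (hba : ∀ n m, n + L ≤ m → 5 * (b n : ℝ) ≤ (1 - θ) * a m)
    (hbb : ∀ n m, n + L ≤ m → 5 * (b n : ℝ) ≤ (1 - θ) * b m) {i j : ℕ} (hij : i < j)
    (hji : j ≤ i + L) :
    QuadraticallySeparated
      (Set.range (fun k => a (i + k * (2 * L))) ×ˢ Set.range (fun k => b (j + k * (2 * L)))) := by
  have hle : ∀ (c : ℕ+) {y : ℝ}, y ≤ (1 - θ) * (c : ℝ) → y ≤ c := fun c y h =>
    h.trans (mul_le_of_le_one_left (Nat.cast_nonneg _) (by linarith))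
  have hlt : ∀ k, i + k * (2 * L) < j + k * (2 * L) := fun k => by omega
  have e : ∀ k, (k + 1) * (2 * L) = k * (2 * L) + 2 * L := fun k => by ring
  obtain ⟨p, hp⟩ := exists_phase_of_sub (a := fun k => a (i + k * (2 * L)))
    (b := fun k => b (j + k * (2 * L)))
    (fun k => by
      have h := hθ _ _ (hlt k)
      have h₂ : (0 : ℝ) < b (j + k * (2 * L)) := Nat.cast_pos.mpr (PNat.pos _)
      have : (a (i + k * (2 * L)) : ℝ) < b (j + k * (2 * L)) := by nlinarith
      exact_mod_cast this)
    (fun k => by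
      have h₁ := hθ _ _ (hlt (k + 1))
      have h₂ := hbb (j + k * (2 * L)) (j + (k + 1) * (2 * L)) (by rw [e]; omega)
      have h₃ : (0 : ℝ) < a (i + k * (2 * L)) := Nat.cast_pos.mpr (PNat.pos _)
      linarith)
  refine range_prod_range (fun k => hle _ (haa _ _ ?_)) (fun k => hle _ (hab _ _ ?_))
    (fun k => hle _ (hba _ _ ?_)) (fun k => hle _ (hbb _ _ ?_)) (by norm_num : (0 : ℝ) < 3 / 8) hp
  all_goals
    rw [e]
    omega

/-- As `range_prod_range_of_lt_of_le`, for progressions that differ modulo `2 L`; if `j` is far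
from `i`, it is close to the next term `i + 2 L` of the progression of `i`. -/
theorem range_prod_range_of_lt_of_lt {a b : ℕ → ℕ+} {θ : ℝ} {L : ℕ} (hθ₀ : 0 ≤ θ) (hθ₁ : θ < 1)
    (hθ : ∀ n m, n < m → (a n : ℝ) ≤ θ * b m)
    (hθ' : ∀ n m, n < m → (b n : ℝ) ≤ θ * a m)
    (haa : ∀ n m, n + L ≤ m → 5 * (a n : ℝ) ≤ (1 - θ) * a m)
    (hab : ∀ n m, n + L ≤ m → 5 * (a n : ℝ) ≤ (1 - θ) * b m)
    (hba : ∀ n m, n + L ≤ m → 5 * (b n : ℝ) ≤ (1 - θ) * a m)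
    (hbb : ∀ n m, n + L ≤ m → 5 * (b n : ℝ) ≤ (1 - θ) * b m) {i j : ℕ} (hij : i < j)
    (hji : j < i + 2 * L) :
    QuadraticallySeparated
      (Set.range (fun k => a (i + k * (2 * L))) ×ˢ Set.range (fun k => b (j + k * (2 * L)))) := by
  rcases le_or_gt j (i + L) with h | h
  · exact range_prod_range_of_lt_of_le hθ₀ hθ₁ hθ haa hab hba hbb hij h
  have h₁ := (range_prod_range_of_lt_of_le hθ₀ hθ₁ hθ' hbb hba hab haa hji (by omega)).swap
  have h₂ := (range_singleton (u := fun k => b (j + k * (2 * L))) (fun k => by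
    refine (hbb _ (j + (k + 1) * (2 * L)) (by ring_nf; omega)).trans
      (mul_le_of_le_one_left (Nat.cast_nonneg _) (by linarith))) (a i)).swap
  refine (h₁.union h₂).mono ?_
  rintro ⟨_, _⟩ ⟨⟨k, rfl⟩, ⟨m, rfl⟩⟩
  rcases k with _ | k
  · refine Or.inr ⟨⟨m, rfl⟩, fun h => ?_, by simp⟩
    have h₃ := hθ i (j + m * (2 * L)) (by omega)
    have h₄ : (0 : ℝ) < a i := Nat.cast_pos.mpr (PNat.pos _)
    simp only [Prod.swap_prod_mk] at h
    rw [h] at h₃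
    nlinarith
  · exact Or.inl ⟨⟨m, rfl⟩, ⟨k, by simp only; congr 1; ring⟩⟩

end QuadraticallySeparated

/-- A set contained, up to finitely many points, in the union of two intertwined lacunary sequences
`v false`, `v true` is a `2`-step interpolation set if
`v true n ^ 2 - v false n ^ 2` is lacunary too. -/
theorem isNilInterpolationSet_of_pair {v : Bool → ℕ → ℕ+} {θ : ℝ} {L : ℕ} (hθ₀ : 0 ≤ θ)
    (hθ₁ : θ < 1) (hL : 0 < L)
    (hθ : ∀ τ τ' n m, n < m → (v τ n : ℝ) ≤ θ * v τ' m)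
    (hv : ∀ τ τ' n m, n + L ≤ m → 5 * (v τ n : ℝ) ≤ (1 - θ) * v τ' m)
    (hlt : ∀ n, v false n < v true n)
    (hsq : ∀ n m, n + L ≤ m → 5 * ((v true n : ℝ) ^ 2 - (v false n : ℝ) ^ 2) ≤
      (v true m : ℝ) ^ 2 - (v false m : ℝ) ^ 2)
    {E F : Set ℕ+} (hF : F.Finite) (hE : E ⊆ F ∪ ⋃ τ, Set.range (v τ)) :
    IsNilInterpolationSet 2 E := by
  have hle : ∀ (c : ℕ+) {y : ℝ}, y ≤ (1 - θ) * (c : ℝ) → y ≤ c := fun c y h =>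
    h.trans (mul_le_of_le_one_left (Nat.cast_nonneg _) (by linarith))
  let u : Bool × Fin (2 * L) → ℕ → ℕ+ := fun x k => v x.1 (x.2 + k * (2 * L))
  have hstep : ∀ i k, i + k * (2 * L) + L ≤ i + (k + 1) * (2 * L) := fun i k => by ring_nf; omega
  have hu : ∀ x k, 5 * (u x k : ℝ) ≤ u x (k + 1) := fun x k => hle _ (hv _ _ _ _ (hstep _ _))
  have hne : ∀ x y, x ≠ y →
      QuadraticallySeparated (Set.range (u x) ×ˢ Set.range (u y)) := by
    have hlt' : ∀ x y : Bool × Fin (2 * L), x.2 < y.2 →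
        QuadraticallySeparated (Set.range (u x) ×ˢ Set.range (u y)) := fun x y hxy =>
      QuadraticallySeparated.range_prod_range_of_lt_of_lt hθ₀ hθ₁ (hθ _ _) (hθ _ _) (hv _ _)
        (hv _ _) (hv _ _) (hv _ _) hxy (by omega)
    have heq : ∀ i, QuadraticallySeparated
        (Set.range (u (false, i)) ×ˢ Set.range (u (true, i))) := by
      intro i
      obtain ⟨p, hp⟩ := exists_phase_of_sq_sub (a := u (false, i)) (b := u (true, i))
        (fun k => hlt _) (fun k => hsq _ _ (hstep _ _))
      exact QuadraticallySeparated.range_prod_range (hu _)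
        (fun k => hle _ (hv _ _ _ _ (hstep _ _))) (fun k => hle _ (hv _ _ _ _ (hstep _ _))) (hu _)
        (by norm_num : (0 : ℝ) < 3 / 8) hp
    have hswap : ∀ x y, QuadraticallySeparated (Set.range (u x) ×ˢ Set.range (u y)) →
        QuadraticallySeparated (Set.range (u y) ×ˢ Set.range (u x)) := fun x y h =>
      h.swap.mono fun w hw => ⟨hw.2, hw.1⟩
    rintro ⟨τ, i⟩ ⟨τ', j⟩ hxy
    rcases lt_trichotomy i j with h | rfl | h
    · exact hlt' _ _ h
    · cases τ <;> cases τ'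
      · exact absurd rfl hxy
      · exact heq i
      · exact hswap _ _ (heq i)
      · exact absurd rfl hxy
    · exact hswap _ _ (hlt' _ _ h)
  have := hF.to_subtype
  let piece : F ⊕ Bool × Fin (2 * L) → Set ℕ+ := Sum.elim (fun m => {(m : ℕ+)})
    fun x => Set.range (u x)
  have hpiece : ∀ n ∈ E, ∃ c, n ∈ piece c := by
    intro n hn
    rcases hE hn with h | h
    · exact ⟨Sum.inl ⟨n, h⟩, rfl⟩
    · obtain ⟨τ, k, rfl⟩ := Set.mem_iUnion.mp h
      refine ⟨Sum.inr (τ, ⟨k % (2 * L), Nat.mod_lt _ (by omega)⟩), k / (2 * L), ?_⟩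
      simp only [u]
      rw [Nat.mod_add_div']
  refine isNilInterpolationSet_of_quadraticallySeparated fun A B hA hB hAB => ?_
  have hsep : ∀ {x y}, x ∈ A → y ∈ B → x ≠ y := fun hx hy h => hAB.ne_of_mem hx hy h
  have key : ∀ c : (F ⊕ Bool × Fin (2 * L)) × (F ⊕ Bool × Fin (2 * L)),
      QuadraticallySeparated ((A ∩ piece c.1) ×ˢ (B ∩ piece c.2)) := by
    rintro ⟨m | x, m' | y⟩
    · rcases eq_or_ne (m : ℕ+) m' with h | h
      -- `A` and `B` are disjoint, so here the set of pairs is empty.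
      · refine (QuadraticallySeparated.singleton (show (1 : ℕ+) ≠ 2 by decide)).mono ?_
        rintro ⟨_, _⟩ ⟨⟨hx, rfl⟩, ⟨hy, rfl⟩⟩
        exact absurd h (hsep hx hy)
      · refine (QuadraticallySeparated.singleton h).mono ?_
        rintro ⟨_, _⟩ ⟨⟨hx, rfl⟩, ⟨hy, rfl⟩⟩
        rfl
    · refine (QuadraticallySeparated.range_singleton (hu y) m).swap.mono ?_
      rintro ⟨_, _⟩ ⟨⟨hx, rfl⟩, ⟨hy, hy'⟩⟩
      exact ⟨hy', (hsep hx hy).symm, rfl⟩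
    · refine (QuadraticallySeparated.range_singleton (hu x) m').mono ?_
      rintro ⟨_, _⟩ ⟨⟨hx, hx'⟩, ⟨hy, rfl⟩⟩
      exact ⟨hx', hsep hx hy, rfl⟩
    · rcases eq_or_ne x y with rfl | h
      · exact QuadraticallySeparated.of_disjoint_subset_range (hu x) Set.inter_subset_right
          Set.inter_subset_right (hAB.mono Set.inter_subset_left Set.inter_subset_left)
      · exact (hne x y h).mono (Set.prod_mono Set.inter_subset_right Set.inter_subset_right)
  refine (QuadraticallySeparated.iUnion key).mono ?_
  rintro ⟨x, y⟩ ⟨hx, hy⟩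
  obtain ⟨c, hc⟩ := hpiece x (hA hx)
  obtain ⟨d, hd⟩ := hpiece y (hB hy)
  exact Set.mem_iUnion.mpr ⟨(c, d), ⟨hx, hc⟩, ⟨hy, hd⟩⟩

/-! ### The sequences `r` and `r + t` -/

theorem IsLacunary.exists_ratio {r : ℕ → ℕ+} (hr : IsLacunary r) :
    ∃ c : ℝ, 1 < c ∧ ∀ n, c * r n ≤ r (n + 1) := by
  refine ⟨_, hr.2, fun n => ?_⟩
  have h : (0 : ℝ) < r n := Nat.cast_pos.mpr (r n).pos
  rw [← le_div_iff₀ h]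
  exact ciInf_le ⟨0, by rintro _ ⟨k, rfl⟩; positivity⟩ n

theorem eventually_le_mul {r t : ℕ → ℕ+}
    (hlim : Tendsto (fun n : ℕ => ((t n : ℕ) : ℝ) / ((r n : ℕ) : ℝ)) atTop (𝓝 0))
    {η : ℝ} (hη : 0 < η) : ∃ N, ∀ n ≥ N, (t n : ℝ) < η * r n := by
  obtain ⟨N, hN⟩ := eventually_atTop.mp (hlim.eventually (gt_mem_nhds hη))
  refine ⟨N, fun n hn => ?_⟩
  exact (div_lt_iff₀ (Nat.cast_pos.mpr (r n).pos)).mp (hN n hn)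

/-- The sequences `r` and `r + t` are intertwined lacunary up to finitely many terms, and
`(r + t) ^ 2 - r ^ 2 = t (2 r + t)` is lacunary because `t` does not decrease. -/
theorem isNilInterpolationSet_of_monotone {r t : ℕ → ℕ+} (hr : IsLacunary r)
    (hlim : Tendsto (fun n : ℕ => ((t n : ℕ) : ℝ) / ((r n : ℕ) : ℝ)) atTop (𝓝 0))
    (ht : Monotone t) :
    IsNilInterpolationSet 2 (Set.range r ∪ Set.range (fun n : ℕ => r n + t n)) := by
  obtain ⟨c, hc, hrc⟩ := hr.exists_ratio
  -- With `μ = √c` and `t n ≤ (μ - 1) r n`, half of the growth `c = μ²` absorbs the shifts `t n`.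
  obtain ⟨μ, hμ, hμc⟩ : ∃ μ : ℝ, 1 < μ ∧ μ ^ 2 = c :=
    ⟨√c, Real.lt_sqrt_of_sq_lt (by simpa using hc), Real.sq_sqrt (by linarith)⟩
  have hμ₀ : 0 < μ := by linarith
  obtain ⟨N, hN⟩ := eventually_le_mul hlim (sub_pos.mpr hμ)
  have hθ₁ : μ⁻¹ < 1 := inv_lt_one_of_one_lt₀ hμ
  -- `μ ^ L` accounts for the ratio `5` and for replacing `b` by `b - a` when `a ≤ b / μ`.
  obtain ⟨L, hL⟩ := pow_unbounded_of_one_lt (5 / (1 - μ⁻¹)) hμ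
  rw [div_lt_iff₀ (by linarith)] at hL
  have hpos : ∀ n, (0 : ℝ) < r n := fun n => Nat.cast_pos.mpr (r n).pos
  have hgrow : ∀ n k, c ^ k * r n ≤ (r (n + k) : ℝ) := by
    intro n k
    induction k with
    | zero => simp
    | succ k ih =>
      calc c ^ (k + 1) * r n = c * (c ^ k * r n) := by ring
        _ ≤ c * r (n + k) := by gcongr
        _ ≤ r (n + (k + 1)) := hrc _
  let v : Bool → ℕ → ℕ+ := fun τ n => cond τ (r (N + n) + t (N + n)) (r (N + n))
  have hv₁ : ∀ τ n, (r (N + n) : ℝ) ≤ v τ n := by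
    rintro (_ | _) n
    · exact le_rfl
    · simp [v]
  have hv₂ : ∀ τ n, (v τ n : ℝ) ≤ μ * r (N + n) := by
    rintro (_ | _) n
    · have := hpos (N + n)
      change (r (N + n) : ℝ) ≤ _
      nlinarith
    · have := hN (N + n) (Nat.le_add_right _ _)
      simp only [v, cond_true, PNat.add_coe, Nat.cast_add]
      linarith
  have hv : ∀ τ τ' n k, μ ^ (k + 1) * v τ n ≤ (v τ' (n + (k + 1)) : ℝ) := by
    intro τ τ' n k
    calc μ ^ (k + 1) * v τ n ≤ μ ^ (k + 1) * (μ * r (N + n)) := by gcongr; exact hv₂ τ n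
      _ = μ ^ (k + 2) * r (N + n) := by ring
      _ ≤ μ ^ (2 * (k + 1)) * r (N + n) := by
          gcongr
          · exact hμ.le
          · omega
      _ = c ^ (k + 1) * r (N + n) := by rw [pow_mul, hμc]
      _ ≤ r (N + n + (k + 1)) := hgrow _ _
      _ ≤ v τ' (n + (k + 1)) := by simpa only [add_assoc] using hv₁ τ' (n + (k + 1))
  have hL₀ : 0 < L := by
    by_contra h
    have : 0 < μ⁻¹ := by positivity
    obtain rfl : L = 0 := by omega
    rw [pow_zero] at hL
    linarith
  have hv5 : ∀ τ τ' n m, n + L ≤ m → 5 * (v τ n : ℝ) ≤ (1 - μ⁻¹) * v τ' m := by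
    intro τ τ' n m hnm
    obtain ⟨k, rfl⟩ := Nat.exists_eq_add_of_le hnm
    have h := hv τ τ' n (L + k - 1)
    rw [show L + k - 1 + 1 = L + k by omega, ← add_assoc] at h
    have h₁ : μ ^ L ≤ μ ^ (L + k) := pow_le_pow_right₀ hμ.le (by omega)
    have h₂ : 0 < 1 - μ⁻¹ := by linarith
    calc 5 * (v τ n : ℝ) ≤ (μ ^ L * (1 - μ⁻¹)) * v τ n := by gcongr
      _ = (1 - μ⁻¹) * (μ ^ L * v τ n) := by ring
      _ ≤ (1 - μ⁻¹) * (μ ^ (L + k) * v τ n) := by gcongr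
      _ ≤ (1 - μ⁻¹) * v τ' (n + L + k) := by gcongr
  refine isNilInterpolationSet_of_pair (v := v) (inv_nonneg.mpr hμ₀.le) hθ₁ hL₀ ?_ hv5 ?_ ?_
    (F := r '' Set.Iio N ∪ (fun n => r n + t n) '' Set.Iio N) ?_ ?_
  · intro τ τ' n m hnm
    obtain ⟨k, rfl⟩ := Nat.exists_eq_add_of_lt hnm
    have h := hv τ τ' n k
    have h₁ : μ ^ 1 ≤ μ ^ (k + 1) := pow_le_pow_right₀ hμ.le (by omega)
    rw [pow_one] at h₁
    rw [le_inv_mul_iff₀ hμ₀]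
    exact (mul_le_mul_of_nonneg_right h₁ (Nat.cast_nonneg _)).trans h
  · exact fun n => PNat.lt_add_right _ _
  · intro n m hnm
    have h := hv5 true false n m hnm
    have h₁ : (t (N + n) : ℝ) ≤ t (N + m) := by exact_mod_cast ht (by omega)
    have h₂ := hpos (N + m)
    have h₃ := hpos (N + n)
    have h₄ : 0 < μ⁻¹ := by positivity
    have h₅ : (0 : ℝ) < t (N + n) := Nat.cast_pos.mpr (PNat.pos _)
    simp only [v, cond_true, cond_false, PNat.add_coe, Nat.cast_add] at h ⊢
    have h₆ : 5 * (2 * (r (N + n) : ℝ) + t (N + n)) ≤ 2 * r (N + m) + t (N + m) := by nlinarith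
    calc _ = t (N + n) * (5 * (2 * (r (N + n) : ℝ) + t (N + n))) := by ring
      _ ≤ t (N + m) * (2 * r (N + m) + t (N + m)) := by gcongr
      _ = _ := by ring
  · exact ((Set.finite_Iio N).image _).union ((Set.finite_Iio N).image _)
  · rintro _ (⟨n, rfl⟩ | ⟨n, rfl⟩) <;> rcases lt_or_ge n N with h | h
    · exact Or.inl (Or.inl ⟨n, h, rfl⟩)
    · exact Or.inr (Set.mem_iUnion.mpr ⟨false, n - N, by simp [v, Nat.add_sub_cancel' h]⟩)
    · exact Or.inl (Or.inr ⟨n, h, rfl⟩)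
    · exact Or.inr (Set.mem_iUnion.mpr ⟨true, n - N, by simp [v, Nat.add_sub_cancel' h]⟩)

/-- Finitely many terms may be dropped in Bohr recurrence, because the multiples
`s / (M + 1)` with `1 ≤ s ≤ M` stay away from `0` on the circle. -/
theorem IsBohrRecurrent.exists_ge_mem {t : ℕ → ℕ+} (ht : IsBohrRecurrent (Set.range t)) (N : ℕ)
    {d : ℕ} (α : Fin d → UnitAddCircle) {U : Set (Fin d → UnitAddCircle)} (hU : U ∈ 𝓝 0) :
    ∃ n ≥ N, (t n : ℕ) • α ∈ U := by
  let M : ℕ := ∑ i ∈ Finset.range N, (t i : ℕ)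
  have hM : (0 : ℝ) < M + 1 := by positivity
  let β : Fin (d + 1) → UnitAddCircle := Fin.cons ((1 / (M + 1) : ℝ) : UnitAddCircle) α
  have hV₀ : {y : Fin (d + 1) → UnitAddCircle | ‖y 0‖ < 1 / ((M : ℝ) + 1)} ∈ 𝓝 0 :=
    (isOpen_lt (continuous_apply 0).norm continuous_const).mem_nhds (by simpa using hM)
  have hV₁ : (fun (y : Fin (d + 1) → UnitAddCircle) (j : Fin d) => y j.succ) ⁻¹' U ∈ 𝓝 0 :=
    (continuous_pi fun j => continuous_apply j.succ).continuousAt.preimage_mem_nhds (by exact hU)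
  obtain ⟨_, ⟨hy₀, hy₁⟩, _, ⟨n, rfl⟩, rfl⟩ :=
    mem_closure_iff_nhds.mp (ht (d + 1) β) _ (inter_mem hV₀ hV₁)
  refine ⟨n, ?_, by simpa [β] using! hy₁⟩
  by_contra! hn
  have hle : (t n : ℕ) ≤ M := Finset.single_le_sum (f := fun i => (t i : ℕ))
    (fun _ _ => Nat.zero_le _) (Finset.mem_range.mpr hn)
  have hy : ‖(((t n : ℕ) * (1 / (M + 1)) : ℝ) : UnitAddCircle)‖ < 1 / ((M : ℝ) + 1) := by
    have := hy₀
    simp only [β, Set.mem_ofPred_eq, Pi.smul_apply, Fin.cons_zero] at this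
    rwa [← AddCircle.coe_nsmul, nsmul_eq_mul] at this
  rw [UnitAddCircle.norm_eq, lt_div_iff₀ hM, ← abs_of_pos hM, ← abs_mul, abs_of_pos hM, sub_mul,
    mul_assoc, one_div_mul_cancel hM.ne', mul_one] at hy
  set z := round ((t n : ℕ) * (1 / (M + 1)) : ℝ)
  have hy' : |((t n : ℕ) : ℤ) - z * (M + 1)| < 1 := by exact_mod_cast hy
  rw [Int.abs_lt_one_iff] at hy'
  have hpos := (t n).pos
  have hz : 0 < z := by
    by_contra! hz
    nlinarith
  nlinarith

/-- A Bohr almost periodic sequence takes nearly equal values at `r n` and `r n + t n` for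
arbitrarily large `n`, so it cannot vanish on one and equal `1` on the other. -/
theorem not_isI0Set_of_isBohrRecurrent {r t : ℕ → ℕ+} (hr : IsLacunary r)
    (hlim : Tendsto (fun n : ℕ => ((t n : ℕ) : ℝ) / ((r n : ℕ) : ℝ)) atTop (𝓝 0))
    (ht : IsBohrRecurrent (Set.range t)) :
    ¬ IsI0Set (Set.range r ∪ Set.range (fun n : ℕ => r n + t n)) := by
  classical
  intro hI
  obtain ⟨c, hc, hrc⟩ := hr.exists_ratio
  obtain ⟨N, hN⟩ := eventually_le_mul hlim (sub_pos.mpr hc)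
  -- Beyond `N` no `r m` is of the form `r n + t n`.
  have hlt : ∀ n ≥ N, r n + t n < r (n + 1) := fun n hn => by
    have h₁ := hN n hn
    have h₂ := hrc n
    have : (r n : ℝ) + t n < r (n + 1) := by linarith
    exact_mod_cast this
  have hdisj : ∀ n, ∀ m ≥ N, r n ≠ r m + t m := by
    intro n m hm h
    have h₁ : r m < r n := h ▸ PNat.lt_add_right _ _
    have h₂ : r n < r (m + 1) := h ▸ hlt m hm
    have h₃ := hr.1.lt_iff_lt.mp h₁
    have h₄ := hr.1.lt_iff_lt.mp h₂
    omega
  obtain ⟨ψ, hψ, hψf⟩ := hI (fun n => if ∃ m ≥ N, (n : ℕ+) = r m + t m then 1 else 0)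
    ⟨1, fun n => by split_ifs <;> simp⟩
  obtain ⟨k, a, α, hp⟩ := hψ (1 / 4) (by norm_num)
  let G : (Fin k → UnitAddCircle) → ℝ := fun y => ∑ j, ‖a j‖ * ‖fourier 1 (y j) - 1‖
  have hG : Continuous G := by fun_prop
  have hG₀ : G 0 = 0 := by simp [G]
  obtain ⟨n, hn, hGn⟩ := ht.exists_ge_mem N (fun j => (α j : UnitAddCircle))
    (hG.continuousAt.preimage_mem_nhds (gt_mem_nhds (hG₀.trans_lt (by norm_num : (0 : ℝ) < 1 / 2))))
  have h₀ : ψ (r n) = 0 := by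
    rw [hψf ⟨r n, Or.inl ⟨n, rfl⟩⟩, if_neg]
    rintro ⟨m, hm, h⟩
    exact hdisj n m hm h
  have h₁ : ψ (r n + t n) = 1 := by
    rw [hψf ⟨r n + t n, Or.inr ⟨n, rfl⟩⟩, if_pos ⟨n, hn, rfl⟩]
  let e : ℕ+ → Fin k → ℂ := fun m j =>
    Complex.exp (2 * Real.pi * Complex.I * ((m : ℕ) : ℂ) * (α j : ℂ))
  have hterm : ∀ j, ‖e (r n + t n) j - e (r n) j‖ =
      ‖fourier 1 ((t n : ℕ) • (α j : UnitAddCircle)) - 1‖ := by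
    intro j
    have h : e (r n + t n) j - e (r n) j = e (r n) j * (e (t n) j - 1) := by
      simp only [e, mul_sub, mul_one, ← Complex.exp_add, PNat.add_coe, Nat.cast_add]
      congr 2
      ring
    have h' : ‖e (r n) j‖ = 1 := by
      have : e (r n) j = Complex.exp ((2 * Real.pi * (r n : ℕ) * α j : ℝ) * Complex.I) := by
        simp only [e]
        congr 1
        push_cast
        ring
      rw [this, Complex.norm_exp_ofReal_mul_I]
    rw [h, norm_mul, h', one_mul, ← AddCircle.coe_nsmul, fourier_coe_apply]
    congr 3
    simp only [e, nsmul_eq_mul]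
    push_cast
    ring_nf
  have hdiff : ‖∑ j, a j * e (r n + t n) j - ∑ j, a j * e (r n) j‖ < 1 / 2 := by
    refine lt_of_le_of_lt ?_ hGn
    rw [← Finset.sum_sub_distrib]
    refine (norm_sum_le _ _).trans (Finset.sum_le_sum fun j _ => ?_)
    rw [← mul_sub, norm_mul, hterm]
    rfl
  have q₀ := hp (r n)
  have q₁ := hp (r n + t n)
  rw [h₀, zero_sub, norm_neg] at q₀
  rw [h₁] at q₁
  have q : ‖(1 : ℂ)‖ ≤ ‖1 - ∑ j, a j * e (r n + t n) j‖ +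
      ‖∑ j, a j * e (r n + t n) j - ∑ j, a j * e (r n) j‖ + ‖∑ j, a j * e (r n) j‖ := by
    refine le_trans (le_of_eq ?_) (norm_add₃_le)
    congr 1
    ring
  rw [norm_one] at q
  have q₀' : ‖∑ j, a j * e (r n) j‖ < 1 / 4 := q₀
  have q₁' : ‖1 - ∑ j, a j * e (r n + t n) j‖ < 1 / 4 := q₁
  linarith

theorem corollary1p5 (r t : ℕ → ℕ+) (hr : IsLacunary r)
    (hlim : Tendsto (fun n : ℕ => ((t n : ℕ) : ℝ) / ((r n : ℕ) : ℝ)) atTop (𝓝 0)) :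
    (Monotone t →
      IsNilInterpolationSet 2 (Set.range r ∪ Set.range (fun n : ℕ => r n + t n))) ∧
    (IsBohrRecurrent (Set.range t) →
      ¬ IsI0Set (Set.range r ∪ Set.range (fun n : ℕ => r n + t n))) :=
  ⟨isNilInterpolationSet_of_monotone hr hlim, not_isI0Set_of_isBohrRecurrent hr hlim⟩
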